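/- Let $(R,\mathfrak m)$ be a commutative Artinian local ring whose socle $\operatorname{Soc}(R)=\{x\in R : \mathfrak m x=0\}$ is equal to $\mathfrak m^2$ and whose embedding dimension, that is, the minimal number of generators of $\mathfrak m$, is at least $4$. Let $\omega$ be the canonical module of $R$, that is, the injective hull of the residue field $R/\mathfrak m$, and let $b_i(\omega)$ denote its $i$-th Betti number, the rank of the $i$-th free module in a minimal free resolution $$\cdots \to R^{b_2(\omega)} \to R^{b_1(\omega)} \to R^{b_0(\omega)} \to \omega \to 0.$$ If $b_1(\omega)\le b_0(\omega)$, then $R$ is Gorenstein, that is, $R$ has finite injective dimension as a module over itself. -/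

import Mathlib

open IsLocalRing

universe u v

/-- The socle `{x ∈ M | 𝔪 x = 0}` of a module `M` over a local ring `(R, 𝔪)`. -/
def localSocle (R : Type u) [CommRing R] [IsLocalRing R]
    (M : Type v) [AddCommGroup M] [Module R M] : Submodule R M where
  carrier := {x | ∀ a ∈ maximalIdeal R, a • x = 0}
  add_mem' := fun hx hy a ha => by rw [smul_add, hx a ha, hy a ha, add_zero]
  zero_mem' := fun a _ => smul_zero a
  smul_mem' := fun c x hx a ha => by rw [smul_comm, hx a ha, smul_zero]

/-- A minimal free resolution
`⋯ ⟶ R ^ rank 2 ⟶ R ^ rank 1 ⟶ R ^ rank 0 ⟶ M ⟶ 0`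
by free modules of finite rank: an exact sequence in which the image of each differential
`d i : R ^ rank (i + 1) ⟶ R ^ rank i` is contained in `𝔪 R ^ rank i`. -/
structure MinimalFreeResolution (R : Type u) [CommRing R] [IsLocalRing R]
    (M : Type v) [AddCommGroup M] [Module R M] where
  rank : ℕ → ℕ
  aug : (Fin (rank 0) → R) →ₗ[R] M
  d : ∀ i : ℕ, (Fin (rank (i + 1)) → R) →ₗ[R] (Fin (rank i) → R)
  aug_surjective : Function.Surjective aug
  exact_aug : Function.Exact (d 0) aug
  exact_d : ∀ i : ℕ, Function.Exact (d (i + 1)) (d i)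
  minimal : ∀ i : ℕ,
    LinearMap.range (d i) ≤ maximalIdeal R • (⊤ : Submodule R (Fin (rank i) → R))

/-- A finite module over a local ring is a quotient of some `R ^ n` with kernel in `𝔪 R ^ n`. -/
theorem exists_minimal_cover (R : Type u) [CommRing R] [IsLocalRing R]
    (M : Type v) [AddCommGroup M] [Module R M] [Module.Finite R M] :
    ∃ (n : ℕ) (f : (Fin n → R) →ₗ[R] M), Function.Surjective f ∧
      LinearMap.ker f ≤ maximalIdeal R • (⊤ : Submodule R (Fin n → R)) := by
  let b := Module.finBasis (ResidueField R) (TensorProduct R (ResidueField R) M)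
  choose v hv using fun i =>
    TensorProduct.mk_surjective R M (ResidueField R) Ideal.Quotient.mk_surjective (b i)
  refine ⟨_, Fintype.linearCombination R v, ?_, ?_⟩
  · rw [← LinearMap.range_eq_top, Fintype.range_linearCombination]
    exact IsLocalRing.span_eq_top_of_tmul_eq_basis v b hv
  · intro x hx
    have h1 : ∑ i, residue R (x i) • b i = 0 := by
      have h2 := congrArg (TensorProduct.mk R (ResidueField R) M 1) (LinearMap.mem_ker.1 hx)
      rw [Fintype.linearCombination_apply, map_sum, map_zero] at h2
      rw [← h2]
      refine Finset.sum_congr rfl fun i _ => ?_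
      rw [map_smul, hv i]
      exact algebraMap_smul (ResidueField R) (x i) (b i)
    have h3 := Fintype.linearIndependent_iff.1 b.linearIndependent _ h1
    rw [pi_eq_sum_univ' x]
    refine Submodule.sum_mem _ fun i _ => ?_
    exact Submodule.smul_mem_smul ((residue_eq_zero_iff _).1 (h3 i)) Submodule.mem_top

/-- Minimal free resolutions of finite modules over Noetherian local rings exist. -/
theorem nonempty_minimalFreeResolution (R : Type u) [CommRing R] [IsLocalRing R]
    [IsNoetherianRing R] (M : Type v) [AddCommGroup M] [Module R M] [Module.Finite R M] :
    Nonempty (MinimalFreeResolution R M) := by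
  obtain ⟨n, f, hf, hk⟩ := exists_minimal_cover R M
  have step : ∀ (m : ℕ) (K : Submodule R (Fin m → R)), ∃ (n : ℕ)
      (g : (Fin n → R) →ₗ[R] (Fin m → R)), LinearMap.range g = K ∧
      LinearMap.ker g ≤ maximalIdeal R • (⊤ : Submodule R (Fin n → R)) := by
    intro m K
    obtain ⟨n, g, hg, hk⟩ := exists_minimal_cover R K
    refine ⟨n, K.subtype ∘ₗ g, ?_, ?_⟩
    · rw [LinearMap.range_comp, LinearMap.range_eq_top.2 hg, Submodule.map_top,
        Submodule.range_subtype]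
    · rw [LinearMap.ker_comp_of_ker_eq_bot _ (Submodule.ker_subtype K)]
      exact hk
  choose N g hr hk' using step
  let s : ℕ → (Σ m : ℕ, Submodule R (Fin m → R)) := fun i =>
    Nat.rec ⟨n, LinearMap.ker f⟩ (fun _ p => ⟨N p.1 p.2, LinearMap.ker (g p.1 p.2)⟩) i
  have hs : ∀ i, (s i).2 ≤ maximalIdeal R • (⊤ : Submodule R (Fin (s i).1 → R)) := by
    intro i
    cases i with
    | zero => exact hk
    | succ i => exact hk' _ _
  exact ⟨{
    rank := fun i => (s i).1
    aug := f
    d := fun i => g (s i).1 (s i).2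
    aug_surjective := hf
    exact_aug := LinearMap.exact_iff.2 (hr n (LinearMap.ker f)).symm
    exact_d := fun i => LinearMap.exact_iff.2 (hr (s (i + 1)).1 (s (i + 1)).2).symm
    minimal := fun i => (hr (s i).1 (s i).2).trans_le (hs i) }⟩

open Classical in
/-- The `i`-th Betti number `b_i(M)`: the rank of the `i`-th module in a minimal free resolution
of `M` (which is unique up to isomorphism). If there is no such resolution by free modules of
finite rank, which cannot happen for a finite module over a Noetherian local ring, the value
is `0`. -/
noncomputable def bettiNumber (R : Type u) [CommRing R] [IsLocalRing R]
    (M : Type v) [AddCommGroup M] [Module R M] (i : ℕ) : ℕ :=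
  if h : Nonempty (MinimalFreeResolution R M) then h.some.rank i else 0

/-- `ω` is a canonical module of the Artinian local ring `R`, that is, an injective hull of the
residue field of `R`: it is injective and an essential extension of the residue field. -/
structure IsCanonicalModule (R : Type u) [CommRing R] [IsLocalRing R]
    (ω : Type u) [AddCommGroup ω] [Module R ω] : Prop where
  injective : Module.Injective R ω
  exists_essential : ∃ ι : ResidueField R →ₗ[R] ω, Function.Injective ι ∧
    ∀ N : Submodule R ω, N ⊓ LinearMap.range ι = ⊥ → N = ⊥

/-- A Gorenstein local ring: a Noetherian local ring of finite injective dimension as a module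
over itself. -/
structure IsGorensteinLocalRing (R : Type u) [CommRing R] : Prop where
  isLocalRing : IsLocalRing R
  isNoetherianRing : IsNoetherianRing R
  finite_injectiveDimension :
    ∃ n : ℕ, CategoryTheory.HasInjectiveDimensionLE (ModuleCat.of R R) n

/-! Write `k` for the residue field, `e` for the embedding dimension and `r = b₀(ω)`. Since `𝔪 ^ 3 =
0`, multiplying the image of `𝔪 R ^ r` in `ω` by `e` generators of `𝔪` lands in `Soc ω ≅ k`. This
gives a `k`-linear map `(𝔪 / 𝔪 ^ 2) ^ r → k ^ e`. Its kernel is spanned by the classes of the first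
syzygies, because `Soc ω` is already hit by `𝔪 ^ 2 R ^ r`. Counting dimensions, `r e ≤ b₁(ω) + e`
(`rank_zero_mul_spanFinrank_le`). With `b₁(ω) ≤ r` and `e ≥ 4` this forces `r = 1`. Then `ω` is
cyclic and faithful, hence isomorphic to `R`, so `R` is self-injective. -/

namespace IsCanonicalModule

variable {R : Type u} [CommRing R] [IsLocalRing R] {ω : Type u} [AddCommGroup ω] [Module R ω]

/-- The socle of an injective hull of the residue field is the residue field. -/
theorem exists_range_eq_localSocle (hω : IsCanonicalModule R ω) :
    ∃ ι : ResidueField R →ₗ[R] ω, Function.Injective ι ∧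
      LinearMap.range ι = localSocle R ω := by
  obtain ⟨ι, hι, hess⟩ := hω.exists_essential
  refine ⟨ι, hι, le_antisymm ?_ fun x hx => ?_⟩
  · rintro _ ⟨c, rfl⟩ a ha
    rw [← map_smul, Algebra.smul_def, ResidueField.algebraMap_eq, (residue_eq_zero_iff a).2 ha,
      zero_mul, map_zero]
  · by_cases hx0 : x = 0
    · exact hx0 ▸ Submodule.zero_mem _
    have hne : R ∙ x ⊓ LinearMap.range ι ≠ ⊥ := fun h =>
      hx0 (Submodule.span_singleton_eq_bot.1 (hess _ h))
    obtain ⟨y, ⟨hy, hyι⟩, hy0⟩ := Submodule.exists_mem_ne_zero_of_ne_bot hne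
    obtain ⟨c, rfl⟩ := Submodule.mem_span_singleton.1 hy
    have hc : IsUnit c := by
      by_contra h
      exact hy0 (hx c ((mem_maximalIdeal c).2 h))
    exact (Submodule.smul_mem_iff_of_isUnit _ hc).1 hyι

/-- An injective hull of the residue field is faithful. -/
theorem exists_smul_ne_zero (hω : IsCanonicalModule R ω) {a : R} (ha : a ≠ 0) :
    ∃ x : ω, a • x ≠ 0 := by
  obtain ⟨ι, hι, -⟩ := hω.exists_essential
  let f := LinearMap.toSpanSingleton R R a
  -- As `a ≠ 0`, its annihilator lies in `𝔪`, so `c * a ↦ ι (residue c)` is well defined on `R a`.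
  -- An extension `h` to `R` has `a • h 1 = ι 1 ≠ 0`.
  have hle : LinearMap.ker f ≤ LinearMap.ker (ι ∘ₗ Algebra.linearMap R (ResidueField R)) := by
    intro c hc
    have hca : c * a = 0 := hc
    have hcm : c ∈ maximalIdeal R := by
      by_contra h
      have hu : IsUnit c := by simpa using h
      exact ha (hu.mul_right_eq_zero.1 hca)
    rw [LinearMap.mem_ker, LinearMap.comp_apply, Algebra.linearMap_apply,
      ResidueField.algebraMap_eq, (residue_eq_zero_iff c).2 hcm, map_zero]
  obtain ⟨h, hh⟩ := hω.injective.out ((LinearMap.ker f).liftQ f le_rfl)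
    (LinearMap.ker_eq_bot.1 (Submodule.ker_liftQ_eq_bot _ _ _ le_rfl))
    ((LinearMap.ker f).liftQ _ hle)
  have h1 := hh (Submodule.Quotient.mk 1)
  rw [Submodule.liftQ_apply, Submodule.liftQ_apply] at h1
  refine ⟨h 1, fun h0 => one_ne_zero (α := ResidueField R) (hι ?_)⟩
  have h2 : f 1 = a • 1 := by simp [f]
  rw [h2, map_smul, h0] at h1
  simpa using h1.symm

/-- If the maximal ideal is nilpotent, then an injective hull of the residue field is a Noetherian
module. -/
theorem isNoetherian [IsNoetherianRing R] (hω : IsCanonicalModule R ω)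
    {n : ℕ} (hn : maximalIdeal R ^ n = ⊥) : IsNoetherian R ω := by
  obtain ⟨s, hs⟩ := (maximalIdeal R).fg_of_isNoetherianRing
  have hsm : ∀ a ∈ s, a ∈ maximalIdeal R := fun a ha => hs ▸ Submodule.subset_span ha
  obtain ⟨ι, -, hι⟩ := hω.exists_range_eq_localSocle
  have hsoc : IsNoetherian R (localSocle R ω) := hι ▸ isNoetherian_range ι
  -- Induction on the power of `𝔪` killing `N`: multiplication by the generators of `𝔪` maps `N` to
  -- a finite power of `𝔪 N`, with kernel inside the socle.
  have key : ∀ (n : ℕ) (N : Submodule R ω), (∀ a ∈ maximalIdeal R ^ n, ∀ x ∈ N, a • x = 0) →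
      IsNoetherian R N := by
    intro n
    induction n with
    | zero =>
      intro N hN
      have hN0 : N = ⊥ := eq_bot_iff.2 fun x hx => by simpa using hN 1 (by simp) x hx
      rw [hN0]
      infer_instance
    | succ n ih =>
      intro N hN
      have h1 : IsNoetherian R (maximalIdeal R • N : Submodule R ω) := by
        refine ih _ fun a ha x hx => ?_
        induction hx using Submodule.smul_induction_on' with
        | smul c hc y hy =>
          rw [smul_smul]
          exact hN _ (pow_succ (maximalIdeal R) n ▸ Ideal.mul_mem_mul ha hc) y hy
        | add y _ z _ hy hz => rw [smul_add, hy, hz, add_zero]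
      let g : N →ₗ[R] (s → (maximalIdeal R • N : Submodule R ω)) := LinearMap.pi fun a =>
        ((a : R) • N.subtype).codRestrict _ fun x => Submodule.smul_mem_smul (hsm a a.2) x.2
      have hg : ∀ x : LinearMap.ker g, ((x : N) : ω) ∈ localSocle R ω := by
        intro x a ha
        rw [← hs] at ha
        induction ha using Submodule.span_induction with
        | mem a ha => exact congrArg Subtype.val (congrFun (LinearMap.mem_ker.1 x.2) ⟨a, ha⟩)
        | zero => exact zero_smul _ _
        | add a b _ _ ha hb => rw [add_smul, ha, hb, add_zero]
        | smul c a _ ha => rw [smul_assoc, ha, smul_zero]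
      have h2 : IsNoetherian R (LinearMap.ker g) :=
        isNoetherian_of_injective
          ((N.subtype ∘ₗ (LinearMap.ker g).subtype).codRestrict (localSocle R ω) hg)
          fun x y hxy => Subtype.ext (Subtype.ext (Subtype.ext_iff.1 hxy :))
      exact isNoetherian_of_range_eq_ker (LinearMap.ker g).subtype g (Submodule.range_subtype _)
  have htop := key n ⊤ fun a ha x _ => by
    rw [hn] at ha
    rw [(Submodule.mem_bot R).1 ha, zero_smul]
  exact isNoetherian_top_iff.1 htop

end IsCanonicalModule

/-- A local ring whose socle is `𝔪 ^ 2` and with `𝔪 ≠ 0` has `𝔪 ^ 2 ≠ 0`. -/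
theorem maximalIdeal_sq_ne_bot {R : Type u} [CommRing R] [IsLocalRing R]
    (hSoc : localSocle R R = maximalIdeal R ^ 2) (hm : maximalIdeal R ≠ ⊥) :
    maximalIdeal R ^ 2 ≠ ⊥ := by
  intro h
  refine hm (eq_bot_iff.2 fun x hx => ?_)
  have hx' : x ∈ localSocle R R := fun a ha => by
    have := Ideal.mul_mem_mul ha hx
    rwa [← pow_two, h] at this
  rwa [hSoc, h] at hx'

namespace MinimalFreeResolution

variable {R : Type u} [CommRing R] [IsLocalRing R] {ω : Type u} [AddCommGroup ω] [Module R ω]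

theorem d_apply_mem {M : Type v} [AddCommGroup M] [Module R M] (F : MinimalFreeResolution R M)
    (i : ℕ) (z : Fin (F.rank (i + 1)) → R) (j : Fin (F.rank i)) :
    F.d i z j ∈ maximalIdeal R := by
  have h := F.minimal i ⟨z, rfl⟩
  generalize F.d i z = w at h
  induction h using Submodule.smul_induction_on' with
  | smul a ha y _ => exact Ideal.mul_mem_right _ _ ha
  | add y _ y' _ hy hy' => exact Ideal.add_mem _ hy hy'

/-- If `Soc R = 𝔪 ^ 2 ≠ 0`, then `b₀(ω) e ≤ b₁(ω) + e`, where `e` is the embedding dimension. -/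
theorem rank_zero_mul_spanFinrank_le [IsNoetherianRing R] (hω : IsCanonicalModule R ω)
    (hSoc : localSocle R R = maximalIdeal R ^ 2) (hne : maximalIdeal R ^ 2 ≠ ⊥)
    (F : MinimalFreeResolution R ω) :
    F.rank 0 * (maximalIdeal R).spanFinrank ≤ F.rank 1 + (maximalIdeal R).spanFinrank := by
  obtain ⟨ι, hι, hιs⟩ := hω.exists_range_eq_localSocle
  obtain ⟨s, hcard, hspan⟩ :=
    Submodule.FG.exists_span_finset_card_eq_spanFinrank (maximalIdeal R).fg_of_isNoetherianRing
  have hsm : ∀ a ∈ s, a ∈ maximalIdeal R := fun a ha => hspan ▸ Submodule.subset_span ha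
  -- the image of `𝔪 ^ 2 R ^ r` in `ω` contains the socle
  have hlift : ∀ u ∈ localSocle R ω, ∃ q : Fin (F.rank 0) → R,
      (∀ j, q j ∈ maximalIdeal R ^ 2) ∧ F.aug q = u := by
    intro u hu
    -- For `0 ≠ b ∈ 𝔪 ^ 2 = Soc R`, faithfulness gives `b • x ≠ 0` in `Soc ω`. The socle is
    -- one-dimensional over `k`, so `u` is a multiple of `b • x`.
    obtain ⟨b, hb, hb0⟩ := Submodule.exists_mem_ne_zero_of_ne_bot hne
    obtain ⟨x, hx⟩ := hω.exists_smul_ne_zero hb0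
    have hbx : b • x ∈ localSocle R ω := fun a ha => by
      have hb' := hb
      rw [← hSoc] at hb'
      rw [← mul_smul, ← smul_eq_mul, hb' a ha, zero_smul]
    rw [← hιs] at hu hbx
    obtain ⟨c', rfl⟩ := hu
    obtain ⟨c, hc⟩ := hbx
    have hc0 : c ≠ 0 := by
      rintro rfl
      exact hx (by rw [← hc, map_zero])
    obtain ⟨t, ht⟩ := residue_surjective (c' / c)
    obtain ⟨y, rfl⟩ := F.aug_surjective x
    refine ⟨t • b • y, fun j => ?_, ?_⟩
    · exact Ideal.mul_mem_left _ _ (Ideal.mul_mem_right _ _ hb)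
    · rw [map_smul, map_smul, ← hc, ← map_smul, Algebra.smul_def, ResidueField.algebraMap_eq, ht,
        div_mul_cancel₀ _ hc0]
  let P := Fin (F.rank 0) → maximalIdeal R
  let W := Fin (F.rank 0) → CotangentSpace R
  let incl : P →ₗ[R] (Fin (F.rank 0) → R) :=
    LinearMap.pi fun j => (maximalIdeal R).subtype ∘ₗ LinearMap.proj j
  let π : P →ₗ[R] W := LinearMap.pi fun j => (maximalIdeal R).toCotangent ∘ₗ LinearMap.proj j
  have hπ0 : ∀ p : P, π p = 0 ↔ ∀ j, (p j : R) ∈ maximalIdeal R ^ 2 := fun p => by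
    rw [funext_iff]
    exact forall_congr' fun j => Ideal.toCotangent_eq_zero _ _
  have hπ : Function.Surjective π := fun w => by
    choose p hp using fun j => Ideal.toCotangent_surjective _ (w j)
    exact ⟨p, funext hp⟩
  have hsmul : ∀ a ∈ s, ∀ p : P, a • F.aug (incl p) ∈ localSocle R ω := by
    intro a ha p c hc
    rw [← map_smul, ← map_smul]
    convert map_zero F.aug
    funext j
    have h : a * (p j : R) ∈ localSocle R R := by
      rw [hSoc, pow_two]
      exact Ideal.mul_mem_mul (hsm a ha) (p j).2
    exact h c hc
  let E := (LinearEquiv.ofInjective ι hι).trans (LinearEquiv.ofEq _ _ hιs)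
  let G : P →ₗ[R] (s → ResidueField R) := LinearMap.pi fun a =>
    E.symm.toLinearMap ∘ₗ ((a : R) • (F.aug ∘ₗ incl)).codRestrict _ (hsmul a a.2)
  have hG : ∀ p, G p = 0 ↔ F.aug (incl p) ∈ localSocle R ω := by
    intro p
    have h1 : G p = 0 ↔ ∀ a ∈ s, a • F.aug (incl p) = 0 := by
      rw [funext_iff]
      simp [G, Subtype.ext_iff]
    rw [h1]
    refine ⟨fun h a ha => ?_, fun h a ha => h a (hsm a ha)⟩
    rw [← hspan] at ha
    induction ha using Submodule.span_induction with
    | mem a ha => exact h a ha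
    | zero => exact zero_smul _ _
    | add a b _ _ ha hb => rw [add_smul, ha, hb, add_zero]
    | smul c a _ ha => rw [smul_assoc, ha, smul_zero]
  -- Since `𝔪 ^ 2 = Soc R` is killed by `𝔪`, `G` descends to `W`.
  have hker : LinearMap.ker π ≤ LinearMap.ker G := by
    intro p hp
    rw [LinearMap.mem_ker, hπ0] at hp
    rw [LinearMap.mem_ker, hG]
    intro a ha
    rw [← map_smul]
    convert map_zero F.aug
    funext j
    have h := hp j
    rw [← hSoc] at h
    exact h a ha
  let G₁ : W →ₗ[R] (s → ResidueField R) :=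
    (LinearMap.ker π).liftQ G hker ∘ₗ (π.quotKerEquivOfSurjective hπ).symm.toLinearMap
  have hG₁ : ∀ p, G₁ (π p) = G p := fun p => by
    have h : (π.quotKerEquivOfSurjective hπ).symm (π p) = Submodule.Quotient.mk p :=
      (LinearEquiv.symm_apply_eq _).2 rfl
    simp [G₁, h]
  let G₂ : W →ₗ[ResidueField R] (s → ResidueField R) :=
    G₁.extendScalarsOfSurjective residue_surjective
  let δ : (Fin (F.rank 1) → R) →ₗ[R] P := LinearMap.pi fun j =>
    (LinearMap.proj j ∘ₗ F.d 0).codRestrict (maximalIdeal R) fun z => F.d_apply_mem 0 z j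
  let S := Submodule.span (ResidueField R) (Set.range fun i => π (δ (Pi.single i 1)))
  have hS : ∀ z, π (δ z) ∈ S := fun z => by
    rw [pi_eq_sum_univ' z, map_sum, map_sum]
    refine Submodule.sum_mem _ fun i _ => ?_
    rw [map_smul, map_smul, ← algebraMap_smul (ResidueField R)]
    refine S.smul_mem _ (Submodule.subset_span ⟨i, congrArg (π ∘ δ) ?_⟩)
    ext j
    simp [Pi.single_apply, eq_comm]
  -- If `p` maps into `Soc ω`, subtracting some `q` with entries in `𝔪 ^ 2` makes it a syzygy
  -- without changing its class in `W`.
  have hkerS : LinearMap.ker G₂ ≤ S := by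
    intro w hw
    obtain ⟨p, rfl⟩ := hπ w
    have hp : G p = 0 := (hG₁ p).symm.trans hw
    obtain ⟨q, hq, hqp⟩ := hlift _ ((hG p).1 hp)
    obtain ⟨z, hz⟩ := (F.exact_aug (incl p - q)).1 (by rw [map_sub, hqp, sub_self])
    have h : π (p - δ z) = 0 := by
      rw [hπ0]
      intro j
      have h1 : ((p - δ z) j : R) = q j := by
        change (p j : R) - F.d 0 z j = q j
        rw [hz]
        exact sub_sub_cancel _ _
      rw [h1]
      exact hq j
    rw [map_sub, sub_eq_zero] at h
    exact h ▸ hS z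
  have h1 : Module.finrank (ResidueField R) W = F.rank 0 * (maximalIdeal R).spanFinrank := by
    rw [Module.finrank_pi_fintype, Finset.sum_const, Finset.card_univ, Fintype.card_fin,
      smul_eq_mul, spanFinrank_maximalIdeal_eq_finrank_cotangentSpace]
  have h2 := LinearMap.finrank_range_add_finrank_ker G₂
  have h3 : Module.finrank (ResidueField R) (LinearMap.ker G₂) ≤ F.rank 1 :=
    (Submodule.finrank_mono hkerS).trans ((finrank_range_le_card _).trans_eq (Fintype.card_fin _))
  have h4 : Module.finrank (ResidueField R) (LinearMap.range G₂) ≤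
      (maximalIdeal R).spanFinrank := by
    refine (Submodule.finrank_le _).trans_eq ?_
    rw [Module.finrank_fintype_fun_eq_card, Fintype.card_coe, hcard]
  omega

/-- If the injective hull of the residue field is cyclic, then `R` is self-injective. -/
theorem injective_self_of_rank_zero_eq_one (hω : IsCanonicalModule R ω)
    (F : MinimalFreeResolution R ω) (h1 : F.rank 0 = 1) : Module.Injective R R := by
  have hsub : Subsingleton (Fin (F.rank 0)) := h1 ▸ inferInstance
  let x := F.aug 1
  have hx : Function.Surjective (LinearMap.toSpanSingleton R ω x) := fun y => by
    obtain ⟨v, rfl⟩ := F.aug_surjective y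
    refine ⟨v ⟨0, by omega⟩, ?_⟩
    rw [LinearMap.toSpanSingleton_apply, ← map_smul]
    congr 1
    funext j
    rw [Subsingleton.elim j ⟨0, by omega⟩]
    simp
  -- The annihilator of a generator is that of all of `ω`, which is zero.
  have hinj : Function.Injective (LinearMap.toSpanSingleton R ω x) := by
    rw [injective_iff_map_eq_zero]
    intro a ha
    by_contra ha0
    obtain ⟨y, hy⟩ := hω.exists_smul_ne_zero ha0
    obtain ⟨c, rfl⟩ := hx y
    rw [LinearMap.toSpanSingleton_apply] at ha hy
    exact hy (by rw [smul_comm, ha, smul_zero])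
  exact (Module.Baer.of_equiv (LinearEquiv.ofBijective _ ⟨hinj, hx⟩).symm
    (Module.Baer.of_injective hω.injective)).injective

end MinimalFreeResolution

theorem mainTheorem3 (R : Type u) [CommRing R] [IsLocalRing R] [IsArtinianRing R]
    (hSoc : localSocle R R = maximalIdeal R ^ 2)
    (hm : 4 ≤ (maximalIdeal R).spanFinrank)
    (ω : Type u) [AddCommGroup ω] [Module R ω] (hω : IsCanonicalModule R ω)
    (hb : bettiNumber R ω 1 ≤ bettiNumber R ω 0) :
    IsGorensteinLocalRing R := by
  have hm0 : maximalIdeal R ≠ ⊥ := fun h => by simp [h] at hm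
  have hm3 : maximalIdeal R ^ 3 = ⊥ := by
    rw [eq_bot_iff, pow_succ', Ideal.mul_le, ← hSoc]
    exact fun a ha b hb => hb a ha
  have := hω.isNoetherian hm3
  have hF := nonempty_minimalFreeResolution R ω
  rw [bettiNumber, bettiNumber, dif_pos hF, dif_pos hF] at hb
  -- Both Betti numbers are ranks in the same chosen resolution, so uniqueness of minimal
  -- resolutions is not needed.
  generalize hF.some = F at hb
  have hle := F.rank_zero_mul_spanFinrank_le hω hSoc (maximalIdeal_sq_ne_bot hSoc hm0)
  have hr0 : F.rank 0 ≠ 0 := fun h0 => by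
    have : IsEmpty (Fin (F.rank 0)) := by
      rw [h0]
      infer_instance
    obtain ⟨x, hx⟩ := hω.exists_smul_ne_zero (one_ne_zero (α := R))
    obtain ⟨v, rfl⟩ := F.aug_surjective x
    exact hx (by rw [Subsingleton.elim v 0, map_zero, smul_zero])
  have hr1 : F.rank 0 = 1 := by
    obtain ⟨n, hn⟩ := Nat.exists_eq_succ_of_ne_zero hr0
    rw [hn] at hb hle ⊢
    rcases n with - | n
    · rfl
    -- Here `r = n + 2`, so the bounds give `(n + 1) e ≤ n + 2`, impossible for `e ≥ 4`.
    · nlinarith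
  have hinj := F.injective_self_of_rank_zero_eq_one hω hr1
  have hcat := Module.injective_object_of_injective_module R R
  exact ⟨inferInstance, inferInstance, 0, inferInstance⟩
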